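/- Let $p,q,r\ge 1$ be integers and let $L$ be the oriented link obtained by closing the $4$-braid $\sigma_1^{p}\sigma_2^{-q}\sigma_3^{r}$ (all strands oriented in parallel). The Alexander polynomial $\Delta_L$ of the closure of a $4$-braid $b$ with exponent sum $e_b$ is $$\Delta_L(t)=\Big(\frac{-1}{\sqrt t}\Big)^{e_b-3}\,\frac{1-t}{1-t^4}\,\det\big(I_3-\psi(b)\big),$$ where $\psi:B_4\to GL(3,\mathbb Z[t,t^{-1}])$ is the reduced Burau representation $$\psi(\sigma_1)=\begin{pmatrix}-t&1&0\\0&1&0\\0&0&1\end{pmatrix},\quad \psi(\sigma_2)=\begin{pmatrix}1&0&0\\t&-t&1\\0&0&1\end{pmatrix},\quad \psi(\sigma_3)=\begin{pmatrix}1&0&0\\0&1&0\\0&t&-t\end{pmatrix}.$$ The signature $\sigma(L)$ is the number of positive minus the number of negative eigenvalues of $M+M^{T}$, where $M$ is the Seifert matrix of the surface that Seifert's algorithm produces from the closed braid diagram. For $n\ge1$ put $[n]=\frac{1-s^n}{1-s}=1+s+\dots+s^{n-1}$, where $s=-t$. A Laurent polynomial $\sum_{k=0}^{n}a_ks^{k+m}$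 with integer coefficients and $a_0,a_n\neq0$ is called *symmetric* if $a_k=a_{n-k}$ for all $k$, and *trapezoidal* if for some $0\le i\le j\le n$ $$a_0<a_1<\dots<a_i=a_{i+1}=\dots=a_j>a_{j+1}>\dots>a_n .$$ The *length of its stable part* is the largest integer $l$ such that $a_k=a_{k+1}=\dots=a_{k+l}$ for some $k$ with $0\le k$ and $k+l\le n$. Then the closed braid diagram of $L$ is alternating and, up to multiplication by a unit of $\mathbb Z[t^{1/2},t^{-1/2}]$, $$\Delta_L=[p]\,[q]\,[r].$$ As a polynomial in $s$, $[p][q][r]$ is symmetric and trapezoidal, all its coefficients from the lowest to the highest are positive, and the length $l$ of its stable part satisfies $l\le|\sigma(L)|$. -/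

import Mathlib

open scoped LaurentPolynomial

/-! ### Braid groups and braid words -/

/-- The relators of Artin's presentation of the braid group on `n` strands. The generator with
index `i : Fin (n - 1)` is the elementary braid `σ_{i+1}`. -/
def braidRels (n : ℕ) : Set (FreeGroup (Fin (n - 1))) :=
  {x | ∃ i j : Fin (n - 1), (i : ℕ) + 2 ≤ (j : ℕ) ∧
      x = FreeGroup.of i * FreeGroup.of j * (FreeGroup.of j * FreeGroup.of i)⁻¹} ∪
  {x | ∃ i j : Fin (n - 1), (i : ℕ) + 1 = (j : ℕ) ∧
      x = FreeGroup.of i * FreeGroup.of j * FreeGroup.of i *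
        (FreeGroup.of j * FreeGroup.of i * FreeGroup.of j)⁻¹}

/-- The braid group `B_n` on `n` strands. -/
abbrev BraidGroup (n : ℕ) : Type := PresentedGroup (braidRels n)

/-- The elementary braid `σ_{i+1}` of `B_n`. -/
def elemBraid {n : ℕ} (i : Fin (n - 1)) : BraidGroup n := PresentedGroup.of i

/-- A braid word on `n` strands, read from the first crossing to the last: the letter `(i, true)` is
the positive crossing `σ_{i+1}` and `(i, false)` is the negative crossing `σ_{i+1}⁻¹`. A braid word
is the same as a braid diagram, and it is used here to denote the oriented link diagram obtained by
closing up that braid diagram, all strands being oriented in parallel. -/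
abbrev BraidWord (n : ℕ) : Type := List (Fin (n - 1) × Bool)

/-- The braid that a braid word represents. -/
def BraidWord.toBraid {n : ℕ} (w : BraidWord n) : BraidGroup n :=
  PresentedGroup.mk (braidRels n) (FreeGroup.mk w)

/-- The word `σ₁ᵖ σ₂⁻ᵠ σ₃ʳ` on four strands. -/
def fourBraidWord (p q r : ℕ) : BraidWord 4 :=
  List.replicate p ((0 : Fin 3), true) ++ List.replicate q ((1 : Fin 3), false) ++
    List.replicate r ((2 : Fin 3), true)

theorem toBraid_append {n : ℕ} (v w : BraidWord n) :
    BraidWord.toBraid (v ++ w) = v.toBraid * w.toBraid := by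
  simp only [BraidWord.toBraid, ← FreeGroup.mul_mk, map_mul]

theorem toBraid_replicate {n : ℕ} (i : Fin (n - 1)) (b : Bool) (m : ℕ) :
    BraidWord.toBraid (List.replicate m (i, b)) =
      elemBraid i ^ (if b then (m : ℤ) else -(m : ℤ)) := by
  induction m with
  | zero => simp [BraidWord.toBraid, ← FreeGroup.one_eq_mk]
  | succ m ih =>
    rw [List.replicate_succ', toBraid_append, ih]
    have h : BraidWord.toBraid [(i, b)] = elemBraid i ^ (if b then (1 : ℤ) else -1) := by
      cases b
      · simp only [BraidWord.toBraid, elemBraid, PresentedGroup.of]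
        simp [← map_inv, FreeGroup.of, FreeGroup.inv_mk, FreeGroup.invRev]
      · simp [BraidWord.toBraid, elemBraid, PresentedGroup.of, FreeGroup.of]
    rw [h, ← zpow_add]
    congr 1
    cases b <;> simp <;> ring

/-- The braid word `fourBraidWord p q r` represents the braid `σ₁ᵖ σ₂⁻ᵠ σ₃ʳ`. -/
theorem toBraid_fourBraidWord (p q r : ℕ) :
    (fourBraidWord p q r).toBraid =
      elemBraid (0 : Fin 3) ^ (p : ℤ) * elemBraid (1 : Fin 3) ^ (-(q : ℤ)) *
        elemBraid (2 : Fin 3) ^ (r : ℤ) := by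
  rw [fourBraidWord, toBraid_append, toBraid_append, toBraid_replicate, toBraid_replicate,
    toBraid_replicate]
  rfl

/-- The exponent sum of a braid, as a homomorphism to the integers. -/
def exponentSum (n : ℕ) : BraidGroup n →* Multiplicative ℤ :=
  PresentedGroup.toGroup (f := fun _ => Multiplicative.ofAdd (1 : ℤ)) (by
    rintro x (⟨i, j, -, rfl⟩ | ⟨i, j, -, rfl⟩) <;> simp)

/-! ### The reduced Burau representation of `B_4` and the Alexander polynomial -/

section Burau

open LaurentPolynomial

theorem T_mul_T_neg (m : ℤ) : (T m * T (-m) : ℤ[T;T⁻¹]) = 1 := by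
  rw [← T_add, add_neg_cancel, T_zero]

theorem T_neg_mul_T (m : ℤ) : (T (-m) * T m : ℤ[T;T⁻¹]) = 1 := by
  rw [← T_add, neg_add_cancel, T_zero]

theorem burauOne_mul_inv {R : Type*} [CommRing R] {t u : R} (h : t * u = 1) :
    (!![-t, 1, 0; 0, 1, 0; 0, 0, 1] * !![-u, u, 0; 0, 1, 0; 0, 0, 1] :
      Matrix (Fin 3) (Fin 3) R) = 1 := by
  ext1 i j
  fin_cases i <;> fin_cases j <;>
    simp [Matrix.mul_apply, Fin.sum_univ_three, h, mul_comm u t]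

theorem burauOne_inv_mul {R : Type*} [CommRing R] {t u : R} (h : t * u = 1) :
    (!![-u, u, 0; 0, 1, 0; 0, 0, 1] * !![-t, 1, 0; 0, 1, 0; 0, 0, 1] :
      Matrix (Fin 3) (Fin 3) R) = 1 := by
  ext1 i j
  fin_cases i <;> fin_cases j <;>
    simp [Matrix.mul_apply, Fin.sum_univ_three, h, mul_comm u t]

/-- The image of `σ₁`, over `ℤ[t, t⁻¹]` with `t = T 1`. -/
noncomputable def burauOne : Matrix.GeneralLinearGroup (Fin 3) ℤ[T;T⁻¹] where
  val := !![-T 1, 1, 0; 0, 1, 0; 0, 0, 1]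
  inv := !![-T (-1), T (-1), 0; 0, 1, 0; 0, 0, 1]
  val_inv := burauOne_mul_inv (T_mul_T_neg 1)
  inv_val := burauOne_inv_mul (T_mul_T_neg 1)

theorem burauTwo_mul_inv {R : Type*} [CommRing R] {t u : R} (h : t * u = 1) :
    (!![1, 0, 0; t, -t, 1; 0, 0, 1] * !![1, 0, 0; 1, -u, u; 0, 0, 1] :
      Matrix (Fin 3) (Fin 3) R) = 1 := by
  ext1 i j
  fin_cases i <;> fin_cases j <;>
    simp [Matrix.mul_apply, Fin.sum_univ_three, h, mul_comm u t]

theorem burauTwo_inv_mul {R : Type*} [CommRing R] {t u : R} (h : t * u = 1) :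
    (!![1, 0, 0; 1, -u, u; 0, 0, 1] * !![1, 0, 0; t, -t, 1; 0, 0, 1] :
      Matrix (Fin 3) (Fin 3) R) = 1 := by
  ext1 i j
  fin_cases i <;> fin_cases j <;>
    simp [Matrix.mul_apply, Fin.sum_univ_three, h, mul_comm u t]

/-- The image of `σ₂`. -/
noncomputable def burauTwo : Matrix.GeneralLinearGroup (Fin 3) ℤ[T;T⁻¹] where
  val := !![1, 0, 0; T 1, -T 1, 1; 0, 0, 1]
  inv := !![1, 0, 0; 1, -T (-1), T (-1); 0, 0, 1]
  val_inv := burauTwo_mul_inv (T_mul_T_neg 1)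
  inv_val := burauTwo_inv_mul (T_mul_T_neg 1)

theorem burauThree_mul_inv {R : Type*} [CommRing R] {t u : R} (h : t * u = 1) :
    (!![1, 0, 0; 0, 1, 0; 0, t, -t] * !![1, 0, 0; 0, 1, 0; 0, 1, -u] :
      Matrix (Fin 3) (Fin 3) R) = 1 := by
  ext1 i j
  fin_cases i <;> fin_cases j <;>
    simp [Matrix.mul_apply, Fin.sum_univ_three, h, mul_comm u t]

theorem burauThree_inv_mul {R : Type*} [CommRing R] {t u : R} (h : t * u = 1) :
    (!![1, 0, 0; 0, 1, 0; 0, 1, -u] * !![1, 0, 0; 0, 1, 0; 0, t, -t] :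
      Matrix (Fin 3) (Fin 3) R) = 1 := by
  ext1 i j
  fin_cases i <;> fin_cases j <;>
    simp [Matrix.mul_apply, Fin.sum_univ_three, h, mul_comm u t]

/-- The image of `σ₃`. -/
noncomputable def burauThree : Matrix.GeneralLinearGroup (Fin 3) ℤ[T;T⁻¹] where
  val := !![1, 0, 0; 0, 1, 0; 0, T 1, -T 1]
  inv := !![1, 0, 0; 0, 1, 0; 0, 1, -T (-1)]
  val_inv := burauThree_mul_inv (T_mul_T_neg 1)
  inv_val := burauThree_inv_mul (T_mul_T_neg 1)

/-- The reduced Burau representation `ψ : B_4 → GL(3, ℤ[t, t⁻¹])`. -/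
noncomputable def burau : BraidGroup 4 →* Matrix.GeneralLinearGroup (Fin 3) ℤ[T;T⁻¹] :=
  PresentedGroup.toGroup (f := ![burauOne, burauTwo, burauThree]) (by
    rintro x (⟨i, j, h, rfl⟩ | ⟨i, j, h, rfl⟩) <;>
      (simp only [map_mul, map_inv, FreeGroup.lift_apply_of, mul_inv_eq_one]
       change Fin 3 at i j
       apply Units.ext
       ext1 a b
       fin_cases i <;> fin_cases j <;> first | (exfalso; simp at h; done) | skip
       all_goals
         fin_cases a <;> fin_cases b <;>
           simp [burauOne, burauTwo, burauThree, Matrix.mul_apply, Fin.sum_univ_three]))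

/-- The ring `ℤ[t^{1/2}, t^{-1/2}]`; here `T 1` stands for `t^{1/2}`, so that `t = T 2`. -/
abbrev HalfLaurent : Type := ℤ[T;T⁻¹]

/-- The inclusion of `ℤ[t, t⁻¹]` into `ℤ[t^{1/2}, t^{-1/2}]`. -/
noncomputable def toHalf : ℤ[T;T⁻¹] →+* HalfLaurent :=
  LaurentPolynomial.eval₂ (Int.castRingHom HalfLaurent)
    (⟨T 2, T (-2), T_mul_T_neg 2, T_neg_mul_T 2⟩ : HalfLaurentˣ)

/-- The ring homomorphism `ℤ[s, s⁻¹] → ℤ[t^{1/2}, t^{-1/2}]` given by the substitution `s = -t`. -/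
noncomputable def substNeg : ℤ[T;T⁻¹] →+* HalfLaurent :=
  LaurentPolynomial.eval₂ (Int.castRingHom HalfLaurent)
    (⟨-T 2, -T (-2), by rw [neg_mul_neg, T_mul_T_neg],
      by rw [neg_mul_neg, T_neg_mul_T]⟩ : HalfLaurentˣ)

/-- The Alexander polynomial of the closure of a `4`-braid `b` with exponent sum `e`,
`(-1 / √t) ^ (e - 3) * ((1 - t) / (1 - t ^ 4)) * det (I - ψ(b))`,
as an element of the field of fractions of `ℤ[t^{1/2}, t^{-1/2}]`. -/
noncomputable def alexanderPolynomial (b : BraidGroup 4) : FractionRing HalfLaurent :=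
  let ι := algebraMap HalfLaurent (FractionRing HalfLaurent)
  (-1 / ι (T 1)) ^ (Multiplicative.toAdd (exponentSum 4 b) - 3) *
    ((1 - ι (T 2)) / (1 - ι (T 2) ^ 4)) *
    ι (toHalf (1 - (burau b : Matrix (Fin 3) (Fin 3) ℤ[T;T⁻¹])).det)

end Burau

/-! ### Alternating closed braid diagrams -/

/-- The crossing `x` involves the strand position `k` (positions are numbered `0, …, n - 1`). -/
def touches {n : ℕ} (x : Fin (n - 1) × Bool) (k : ℕ) : Prop := k = x.1 ∨ k = x.1 + 1

/-- The strand that enters the crossing `x` at position `k` is the overpass there: at a positive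
crossing `σ_{i+1}` the strand that runs from position `i` to position `i + 1` is the overpass, at a
negative crossing it is the other one. -/
def entersOver {n : ℕ} (x : Fin (n - 1) × Bool) (k : ℕ) : Prop := k = x.1 ↔ x.2 = true

/-- The strand that leaves the crossing `x` at position `k` is the overpass there. -/
def leavesOver {n : ℕ} (x : Fin (n - 1) × Bool) (k : ℕ) : Prop := k = x.1 + 1 ↔ x.2 = true

/-- The closure of the braid word `w` is an alternating diagram: whenever a strand leaves a crossing
at position `k` and the next crossing that it meets, going around the closure, is the one `d` steps
later, then it is the overpass at exactly one of these two crossings. -/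
def IsAlternatingClosure {n : ℕ} (w : BraidWord n) : Prop :=
  ∀ (k : ℕ) (x y : Fin (n - 1) × Bool) (j d : ℕ), j < w.length → 0 < d →
    w[j]? = some x → w[(j + d) % w.length]? = some y → touches x k → touches y k →
    (∀ e, 0 < e → e < d → ∀ z, w[(j + e) % w.length]? = some z → ¬ touches z k) →
    (leavesOver x k ↔ ¬ entersOver y k)

/-! ### The Seifert matrix and the signature of a closed braid -/

/-- The sign of a letter of a braid word. -/
def crossingSign {n : ℕ} (x : Fin (n - 1) × Bool) : ℤ := if x.2 then 1 else -1

/-- Seifert's algorithm applied to the closure of a braid word `w` on `n` strands gives `n` parallel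
discs, stacked along an axis, and one half-twisted band for each letter, joining the discs `i` and
`i + 1` when the letter is `σ_{i+1}^{±1}`. A pair of consecutive bands between the same two discs
determines a loop on this surface, which goes up along the disc `i` from the first band to the
second, crosses to the disc `i + 1`, goes down to the first band, and returns. When every generator
occurs in `w` these loops form a basis of the first homology of the surface; in general they form a
basis of the direct sum of the first homology groups of its components. -/
def SeifertLoop {n : ℕ} (w : BraidWord n) : Type :=
  {a : Fin w.length × Fin w.length //
    a.1 < a.2 ∧ (w.get a.1).1 = (w.get a.2).1 ∧
      ∀ l, a.1 < l → l < a.2 → (w.get l).1 ≠ (w.get a.1).1}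

instance {n : ℕ} (w : BraidWord n) : Fintype (SeifertLoop w) := by
  unfold SeifertLoop; infer_instance

instance {n : ℕ} (w : BraidWord n) : DecidableEq (SeifertLoop w) := by
  unfold SeifertLoop; infer_instance

namespace SeifertLoop

variable {n : ℕ} {w : BraidWord n}

/-- The first band of the loop. -/
def fst (a : SeifertLoop w) : Fin w.length := a.1.1

/-- The second band of the loop. -/
def snd (a : SeifertLoop w) : Fin w.length := a.1.2

/-- The lower of the two discs that the loop visits. -/
def col (a : SeifertLoop w) : ℕ := (w.get a.fst).1

end SeifertLoop

/-- The linking number `lk(a, b⁺)` of the loop `a` and the loop `b` pushed off the surface in the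
direction of the discs of higher index. -/
def seifertEntry {n : ℕ} {w : BraidWord n} (a b : SeifertLoop w) : ℤ :=
  if a = b then
    if crossingSign (w.get a.fst) = crossingSign (w.get a.snd) then -crossingSign (w.get a.fst)
    else 0
  else if b.snd = a.fst ∧ crossingSign (w.get a.fst) = 1 then 1
  else if a.snd = b.fst ∧ crossingSign (w.get a.snd) = -1 then -1
  else if a.col = b.col + 1 then
    if b.fst < a.fst ∧ a.fst < b.snd ∧ b.snd < a.snd then -1
    else if a.fst < b.fst ∧ b.fst < a.snd ∧ a.snd < b.snd then 1
    else 0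
  else 0

/-- The Seifert matrix of the closure of a braid word. -/
def seifertMatrix {n : ℕ} (w : BraidWord n) : Matrix (SeifertLoop w) (SeifertLoop w) ℤ :=
  Matrix.of seifertEntry

/-- The signature of a real symmetric matrix: the number of positive eigenvalues minus the number of
negative eigenvalues, counted with multiplicity. -/
noncomputable def matrixSignature {ι : Type*} [Fintype ι] [DecidableEq ι] (S : Matrix ι ι ℝ) : ℤ :=
  (S.charpoly.roots.countP (fun x => 0 < x) : ℤ) - (S.charpoly.roots.countP (fun x => x < 0) : ℤ)

/-- The signature of the closure of a braid word: the signature of `M + Mᵀ` for the Seifert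
matrix `M`. -/
noncomputable def linkSignature {n : ℕ} (w : BraidWord n) : ℤ :=
  matrixSignature ((seifertMatrix w + (seifertMatrix w).transpose).map (Int.cast : ℤ → ℝ))

/-! ### Trapezoidal polynomials -/

section Trapezoidal

open LaurentPolynomial

/-- `f(s) = ∑_{k=0}^{n} a_k s^{k+r}` with nonzero extreme coefficients `a_0` and `a_n`. -/
def IsExpansion (f : ℤ[T;T⁻¹]) (r : ℤ) (n : ℕ) (a : ℕ → ℤ) : Prop :=
  f = ∑ k ∈ Finset.range (n + 1), C (a k) * T ((k : ℤ) + r) ∧ a 0 ≠ 0 ∧ a n ≠ 0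

/-- All coefficients between the lowest and the highest one are positive. -/
def HasPositiveCoeffs (f : ℤ[T;T⁻¹]) : Prop :=
  ∃ r n a, IsExpansion f r n a ∧ ∀ k ≤ n, 0 < a k

/-- `a_k = a_{n-k}` for all `0 ≤ k ≤ n`. -/
def IsSymmetricLaurent (f : ℤ[T;T⁻¹]) : Prop :=
  ∃ r n a, IsExpansion f r n a ∧ ∀ k ≤ n, a k = a (n - k)

/-- `a_0 < a_1 < … < a_i = a_{i+1} = … = a_j > a_{j+1} > … > a_n` for some `0 ≤ i ≤ j ≤ n`. -/
def IsTrapezoidal (f : ℤ[T;T⁻¹]) : Prop :=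
  ∃ r n a, IsExpansion f r n a ∧ ∃ i j, i ≤ j ∧ j ≤ n ∧
    (∀ k, k < i → a k < a (k + 1)) ∧
    (∀ k, i ≤ k → k < j → a k = a (k + 1)) ∧
    (∀ k, j ≤ k → k < n → a (k + 1) < a k)

/-- The length of the stable part of `f` is `l`: the largest `l` such that
`a_k = a_{k+1} = … = a_{k+l}` for some `k`, where `0 ≤ k` and `k + l ≤ n`. -/
def IsStableLength (f : ℤ[T;T⁻¹]) (l : ℕ) : Prop :=
  ∃ r n a, IsExpansion f r n a ∧
    IsGreatest {m : ℕ | ∃ k, k + m ≤ n ∧ ∀ i ≤ m, a (k + i) = a k} l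

/-- `[n] = (1 - s^n) / (1 - s) = 1 + s + … + s^{n-1}`, with `s = T 1`. -/
noncomputable def bracket (n : ℕ) : ℤ[T;T⁻¹] := ∑ i ∈ Finset.range n, T (i : ℤ)

theorem one_sub_mul_bracket (n : ℕ) : (1 - T 1) * bracket n = 1 - T (n : ℤ) := by
  have h : ∀ i : ℕ, (T (i : ℤ) : ℤ[T;T⁻¹]) = T 1 ^ i := fun i => by simp [T_pow]
  simp only [bracket, h]
  exact mul_neg_geom_sum _ _

end Trapezoidal

/-!
In `σ₁ᵖ σ₂⁻ᵠ σ₃ʳ` the sign of a crossing is determined by the parity of its generator, so a strand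
leaves a crossing as the overstrand or the understrand according to the parity of its new position
alone; this makes the closed diagram alternating.

With `s = -t`, `ψ(σᵢ) = 1 + Eᵢ` where `Eᵢ` has a single nonzero row and `Eᵢ² = (s - 1) Eᵢ`. Hence
`ψ(σᵢ)ⁿ = 1 + [n] Eᵢ`, and `ψ(σᵢ)⁻ⁿ = 1 + u [n] Eᵢ` with `u` a unit, so that `det (1 - ψ(b))` is
`[p] [q] [r]` times a unit and the determinant `-(1 - s + s² - s³)` of the matrix of the three rows.

The coefficients of `f * [c]` have differences `f_{k + 1} - f_{k + 1 - c}`. If `f` is symmetric and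
trapezoidal, their signs can be read off from the distances of `k + 1` and `k + 1 - c` to the centre
of symmetry, and `f * [c]` is again symmetric and trapezoidal with an explicit plateau.

When equal generators are adjacent in the word and carry equal signs, the symmetrized Seifert form
is the positive definite form `a, b ↦ ⟨∂a, ∂b⟩`, where `∂` sends a loop to the difference of its
bands, up to minus the crossing sign on each block of loops of one generator. A generator with `m`
crossings thus contributes `∓(m - 1)` to the signature, which equals `q + 1 - p - r`.
-/

section Alternating

variable {n : ℕ}

theorem entersOver_iff_not_leavesOver {x : Fin (n - 1) × Bool} {k : ℕ} (hx : touches x k) :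
    entersOver x k ↔ ¬ leavesOver x k := by
  rcases hx with rfl | rfl <;> simp [entersOver, leavesOver]

theorem leavesOver_iff_of_sign_alternates {x : Fin (n - 1) × Bool} {b : Bool} {k : ℕ}
    (hx : x.2 = b ↔ Even (x.1 : ℕ)) (hk : touches x k) :
    leavesOver x k ↔ (Odd k ↔ b = true) := by
  rcases x with ⟨i, c⟩
  rcases hk with rfl | rfl <;> cases b <;> cases c <;> simp_all [leavesOver]

theorem isAlternatingClosure_of_sign_alternates {w : BraidWord n} {b : Bool}
    (hw : ∀ x ∈ w, x.2 = b ↔ Even (x.1 : ℕ)) : IsAlternatingClosure w := by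
  intro k x y j d _ _ hx hy hxk hyk _
  rw [entersOver_iff_not_leavesOver hyk, not_not,
    leavesOver_iff_of_sign_alternates (hw x (List.mem_of_getElem? hx)) hxk,
    leavesOver_iff_of_sign_alternates (hw y (List.mem_of_getElem? hy)) hyk]

end Alternating

theorem sign_fourBraidWord_iff_even {p q r : ℕ} (x : Fin 3 × Bool)
    (hx : x ∈ fourBraidWord p q r) : x.2 = true ↔ Even (x.1 : ℕ) := by
  simp only [fourBraidWord, List.mem_append, List.mem_replicate] at hx
  rcases hx with (⟨-, rfl⟩ | ⟨-, rfl⟩) | ⟨-, rfl⟩ <;> decide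

section Burau

open LaurentPolynomial Matrix Finset

section GeomSum

variable {R A : Type*} [CommRing R] [Ring A] [Algebra R A] {s : R} {E : A}

theorem one_add_pow_of_mul_self_eq_smul (hE : E * E = (s - 1) • E) (n : ℕ) :
    (1 + E) ^ n = 1 + (∑ i ∈ range n, s ^ i) • E := by
  induction n with
  | zero => simp
  | succ n ih =>
    calc (1 + E) ^ (n + 1)
        = 1 + ((∑ i ∈ range n, s ^ i) * (s - 1) + 1 + ∑ i ∈ range n, s ^ i) • E := by
          rw [pow_succ, ih, add_mul, one_mul, mul_add, mul_one, smul_mul_assoc, hE]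
          module
      _ = 1 + (∑ i ∈ range (n + 1), s ^ i) • E := by
          rw [geom_sum_mul, sum_range_succ, sub_add_cancel, add_comm (s ^ n)]

theorem val_inv_pow_of_mul_self_eq_smul {U : Aˣ} {t : R} (hst : s * t = 1)
    (hE : E * E = (s - 1) • E) (hU : (U : A) = 1 + E) (n : ℕ) :
    (((U ^ n)⁻¹ : Aˣ) : A) = 1 + (-(t ^ n * ∑ i ∈ range n, s ^ i)) • E := by
  rw [Units.inv_eq_of_mul_eq_one_right]
  have hn : s ^ n * t ^ n = 1 := by rw [← mul_pow, hst, one_pow]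
  rw [Units.val_pow_eq_pow_val, hU, one_add_pow_of_mul_self_eq_smul hE]
  set g := ∑ i ∈ range n, s ^ i
  have hgs : g * (s - 1) = s ^ n - 1 := geom_sum_mul s n
  calc (1 + g • E) * (1 + (-(t ^ n * g)) • E)
      = 1 + (g - t ^ n * g - t ^ n * g * (g * (s - 1))) • E := by
        rw [add_mul, one_mul, mul_add, mul_one, smul_mul_smul_comm, hE]
        module
    _ = 1 := by
        rw [hgs, show g - t ^ n * g - t ^ n * g * (s ^ n - 1) = 0 by linear_combination -g * hn,
          zero_smul, add_zero]

end GeomSum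

section Matrices

variable {R : Type*} [CommRing R]

theorem updateRow_zero_mul_self {m : Type*} [Fintype m] [DecidableEq m] (i : m) (v : m → R) :
    updateRow 0 i v * updateRow 0 i v = v i • updateRow 0 i v := by
  ext j k
  by_cases hj : j = i <;> simp [mul_apply, hj, updateRow_apply]

theorem det_one_sub_mul_mul_one_add_updateRow (F : Matrix (Fin 3) (Fin 3) R) (a b c : R) :
    (1 - (1 + a • updateRow 0 0 (F 0)) * (1 + b • updateRow 0 1 (F 1)) *
      (1 + c • updateRow 0 2 (F 2)) : Matrix (Fin 3) (Fin 3) R).det = -(a * b * c) * F.det := by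
  simp [det_fin_three, mul_apply, Fin.sum_univ_three, updateRow_apply]
  ring

/-- The matrix whose `i`-th row is the only nonzero row of `ψ(σᵢ) - 1`, where `ψ` is the reduced
Burau representation; the entries are written in `s = -t`. -/
def burauRows (s : R) : Matrix (Fin 3) (Fin 3) R :=
  !![s - 1, 1, 0; -s, s - 1, 1; 0, -s, s - 1]

theorem det_burauRows (s : R) : (burauRows s).det = -(1 - s + s ^ 2 - s ^ 3) := by
  simp [burauRows, det_fin_three]
  ring

end Matrices

/-- `ψ(σᵢ) - 1` for the reduced Burau representation `ψ`: its only nonzero row is the `i`-th one. -/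
noncomputable def burauDefect (i : Fin 3) : Matrix (Fin 3) (Fin 3) ℤ[T;T⁻¹] :=
  updateRow 0 i (burauRows (-T 1) i)

theorem burauDefect_mul_self (i : Fin 3) :
    burauDefect i * burauDefect i = (-T 1 - 1 : ℤ[T;T⁻¹]) • burauDefect i := by
  rw [burauDefect, updateRow_zero_mul_self]
  fin_cases i <;> rfl

theorem val_burau_elemBraid (i : Fin 3) :
    (burau (elemBraid i) : Matrix (Fin 3) (Fin 3) ℤ[T;T⁻¹]) = 1 + burauDefect i := by
  have h : burau (elemBraid i) = ![burauOne, burauTwo, burauThree] i := by simp [burau, elemBraid]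
  rw [h]
  ext j k
  fin_cases i <;> fin_cases j <;> fin_cases k <;>
    simp [burauOne, burauTwo, burauThree, burauDefect, burauRows]

theorem val_burau_elemBraid_pow (i : Fin 3) (n : ℕ) :
    ((burau (elemBraid i) ^ n : GL (Fin 3) ℤ[T;T⁻¹]) : Matrix (Fin 3) (Fin 3) ℤ[T;T⁻¹]) =
      1 + (∑ k ∈ range n, (-T 1 : ℤ[T;T⁻¹]) ^ k) • burauDefect i := by
  rw [Units.val_pow_eq_pow_val, val_burau_elemBraid,
    one_add_pow_of_mul_self_eq_smul (burauDefect_mul_self i)]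

theorem val_burau_elemBraid_inv_pow (i : Fin 3) (n : ℕ) :
    (((burau (elemBraid i) ^ n)⁻¹ : GL (Fin 3) ℤ[T;T⁻¹]) : Matrix (Fin 3) (Fin 3) ℤ[T;T⁻¹]) =
      1 + (-((-T (-1)) ^ n * ∑ k ∈ range n, (-T 1 : ℤ[T;T⁻¹]) ^ k)) • burauDefect i := by
  have hst : (-T 1 * -T (-1) : ℤ[T;T⁻¹]) = 1 := by rw [neg_mul_neg, T_mul_T_neg]
  exact val_inv_pow_of_mul_self_eq_smul hst (burauDefect_mul_self i) (val_burau_elemBraid i) n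

theorem det_one_sub_burau_fourBraidWord (p q r : ℕ) :
    (1 - (burau (fourBraidWord p q r).toBraid : Matrix (Fin 3) (Fin 3) ℤ[T;T⁻¹])).det =
      -(-T (-1)) ^ q * (1 + T 1 + T 1 ^ 2 + T 1 ^ 3) *
        ((∑ k ∈ range p, (-T 1) ^ k) * (∑ k ∈ range q, (-T 1) ^ k) *
          ∑ k ∈ range r, (-T 1) ^ k) := by
  rw [toBraid_fourBraidWord, map_mul, map_mul, map_zpow, map_zpow, map_zpow, _root_.zpow_neg,
    zpow_natCast, zpow_natCast, zpow_natCast, Units.val_mul, Units.val_mul,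
    val_burau_elemBraid_pow, val_burau_elemBraid_inv_pow, val_burau_elemBraid_pow]
  simp only [burauDefect]
  rw [det_one_sub_mul_mul_one_add_updateRow, det_burauRows]
  ring

theorem toHalf_geom_sum (n : ℕ) :
    toHalf (∑ i ∈ range n, (-T 1) ^ i) = substNeg (bracket n) := by
  simp [bracket, substNeg, toHalf]

theorem T_two_pow_four_ne_one : (T 2 ^ 4 : HalfLaurent) ≠ 1 := by
  rw [T_pow, ← T_zero]
  intro h
  have hdeg := congrArg LaurentPolynomial.degree h
  rw [degree_T, degree_T] at hdeg
  norm_num at hdeg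

theorem alexanderPolynomial_eq_unit_mul_of_det_eq {b : BraidGroup 4} {f : HalfLaurent}
    (hf : toHalf (1 - (burau b : Matrix (Fin 3) (Fin 3) ℤ[T;T⁻¹])).det =
      (1 + T 2 + T 2 ^ 2 + T 2 ^ 3) * f) :
    ∃ u : HalfLaurentˣ,
      alexanderPolynomial b = algebraMap HalfLaurent (FractionRing HalfLaurent) (u * f) := by
  let ι := algebraMap HalfLaurent (FractionRing HalfLaurent)
  obtain ⟨v, hv⟩ := (isUnit_T (-1) : IsUnit (T (-1) : HalfLaurent)).neg
  have hroot : -1 / ι (T 1) = ((Units.map ι.toMonoidHom v : (FractionRing HalfLaurent)ˣ) :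
      FractionRing HalfLaurent) := by
    have hT : ι (T 1) * ι (T (-1)) = 1 := by rw [← map_mul, T_mul_T_neg, map_one]
    rw [div_eq_iff (left_ne_zero_of_mul_eq_one hT), Units.coe_map, hv]
    change -1 = ι (-T (-1)) * ι (T 1)
    rw [map_neg]
    linear_combination hT
  have hden : 1 - ι (T 2) ^ 4 ≠ 0 := by
    rw [← map_pow, ← map_one ι, ← map_sub]
    exact (map_ne_zero_iff ι (IsFractionRing.injective _ _)).2
      (sub_ne_zero.2 T_two_pow_four_ne_one.symm)
  have hquot : (1 - ι (T 2)) / (1 - ι (T 2) ^ 4) * ι (1 + T 2 + T 2 ^ 2 + T 2 ^ 3) = 1 := by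
    simp only [map_add, map_pow, map_one]
    field_simp
    ring
  refine ⟨v ^ (Multiplicative.toAdd (exponentSum 4 b) - 3), ?_⟩
  calc alexanderPolynomial b
      = (-1 / ι (T 1)) ^ (Multiplicative.toAdd (exponentSum 4 b) - 3) *
          ((1 - ι (T 2)) / (1 - ι (T 2) ^ 4)) * ι ((1 + T 2 + T 2 ^ 2 + T 2 ^ 3) * f) := by
        rw [← hf]; rfl
    _ = (-1 / ι (T 1)) ^ (Multiplicative.toAdd (exponentSum 4 b) - 3) * ι f := by
        rw [map_mul, mul_assoc, ← mul_assoc (_ / _), hquot, one_mul]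
    _ = _ := by
        rw [hroot, ← Units.val_zpow_eq_zpow_val, ← map_zpow, map_mul]
        rfl

theorem alexanderPolynomial_fourBraidWord (p q r : ℕ) :
    ∃ u : HalfLaurentˣ, alexanderPolynomial (fourBraidWord p q r).toBraid =
      algebraMap HalfLaurent (FractionRing HalfLaurent)
        (u * substNeg (bracket p * bracket q * bracket r)) := by
  have hT : toHalf (T 1) = T 2 := by simp [toHalf]
  obtain ⟨v, hv⟩ : IsUnit (-toHalf (-T (-1)) ^ q) :=
    (((isUnit_T (-1) : IsUnit (T (-1) : ℤ[T;T⁻¹])).neg.map toHalf).pow q).neg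
  obtain ⟨u, hu⟩ := alexanderPolynomial_eq_unit_mul_of_det_eq
    (b := (fourBraidWord p q r).toBraid)
    (f := v * substNeg (bracket p * bracket q * bracket r)) (by
      simp only [det_one_sub_burau_fourBraidWord, map_mul, map_neg, map_pow, map_add, map_one,
        toHalf_geom_sum, hT, hv]
      ring)
  exact ⟨u * v, by rw [hu, Units.val_mul, mul_assoc (u : HalfLaurent)]⟩

end Burau

section Coefficients

open LaurentPolynomial Finset

theorem coeff_mul_T {R : Type*} [Semiring R] (f : R[T;T⁻¹]) (m k : ℤ) :
    (f * T m).coeff k = f.coeff (k - m) := by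
  rw [T, AddMonoidAlgebra.coeff_mul_single_apply, mul_one, sub_eq_add_neg]

theorem coeff_mul_bracket (f : ℤ[T;T⁻¹]) (c : ℕ) (k : ℤ) :
    (f * bracket c).coeff k = ∑ j ∈ range c, f.coeff (k - j) := by
  simp only [bracket, mul_sum, AddMonoidAlgebra.coeff_sum, Finsupp.finsetSum_apply,
    coeff_mul_T]

theorem coeff_mul_bracket_succ_sub (f : ℤ[T;T⁻¹]) (c : ℕ) (k : ℤ) :
    (f * bracket c).coeff (k + 1) - (f * bracket c).coeff k =
      f.coeff (k + 1) - f.coeff (k + 1 - c) := by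
  have h : f * bracket c - f * bracket c * T 1 = f - f * T (c : ℤ) := by
    linear_combination f * one_sub_mul_bracket c
  have hcoeff := congrArg (fun g : ℤ[T;T⁻¹] => g.coeff (k + 1)) h
  simpa [coeff_mul_T] using hcoeff

/-- The shape of a product `[c₁] ⋯ [c_m]`: a polynomial of degree at most `n` whose coefficients
increase strictly from `a_0 > 0` up to `a_i`, are constant from `a_i` to `a_{n-i}`, and are
symmetric about `n / 2`. The positivity of `a_0` is the instance `k = -1` of `lt_succ`. -/
structure IsSymmTrapezoid (f : ℤ[T;T⁻¹]) (n i : ℕ) : Prop where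
  two_mul_le : 2 * i ≤ n
  coeff_of_neg : ∀ k : ℤ, k < 0 → f.coeff k = 0
  coeff_sub : ∀ k : ℤ, f.coeff (n - k) = f.coeff k
  lt_succ : ∀ k : ℤ, -1 ≤ k → k < i → f.coeff k < f.coeff (k + 1)
  eq_succ : ∀ k : ℤ, (i : ℤ) ≤ k → k < n - i → f.coeff k = f.coeff (k + 1)

theorem isSymmTrapezoid_one : IsSymmTrapezoid 1 0 0 where
  two_mul_le := le_rfl
  coeff_of_neg k hk := by rw [← T_zero, T_apply, if_neg hk.ne']
  coeff_sub k := by simp only [← T_zero, T_apply]; grind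
  lt_succ k hk hk' := by simp only [← T_zero, T_apply]; grind
  eq_succ k hk hk' := by omega

namespace IsSymmTrapezoid

variable {f : ℤ[T;T⁻¹]} {n i : ℕ}

theorem coeff_of_gt (hf : IsSymmTrapezoid f n i) {k : ℤ} (hk : n < k) : f.coeff k = 0 := by
  rw [← hf.coeff_sub, hf.coeff_of_neg _ (by omega)]

theorem coeff_eq_of_mem_plateau (hf : IsSymmTrapezoid f n i) {x y : ℤ} (hx : i ≤ x) (hxy : x ≤ y)
    (hy : y ≤ n - i) : f.coeff x = f.coeff y := by
  induction y, hxy using Int.leInduction with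
  | base => rfl
  | succ y hxy ih => exact (ih (by omega)).trans (hf.eq_succ y (by omega) (by omega))

theorem coeff_le_succ (hf : IsSymmTrapezoid f n i) {k : ℤ} (hk : k < n - i) :
    f.coeff k ≤ f.coeff (k + 1) := by
  rcases lt_or_ge k (-1) with h | h
  · rw [hf.coeff_of_neg k (by omega), hf.coeff_of_neg (k + 1) (by omega)]
  rcases lt_or_ge k i with h' | h'
  · exact (hf.lt_succ k h h').le
  · exact (hf.eq_succ k h' hk).le

theorem coeff_lt_coeff (hf : IsSymmTrapezoid f n i) {x y : ℤ} (hxy : x < y) (hx : x < i)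
    (hy0 : 0 ≤ y) (hy : y ≤ n - i) : f.coeff x < f.coeff y := by
  induction y, hxy using Int.leInduction with
  | base => exact hf.lt_succ x (by omega) hx
  | succ y hxy ih =>
    rcases lt_or_ge y 0 with h | h
    · rw [hf.coeff_of_neg x (by omega)]
      obtain rfl : y = -1 := by omega
      simpa [hf.coeff_of_neg] using hf.lt_succ (-1) le_rfl (by omega)
    · exact (ih h (by omega)).trans_le (hf.coeff_le_succ (by omega))

theorem coeff_lt_coeff_of_lt_sub (hf : IsSymmTrapezoid f n i) {x y : ℤ} (hxy : x < y)
    (hxy' : x < n - y) (hx : x < i) (hy0 : 0 ≤ y) (hy : y ≤ n) : f.coeff x < f.coeff y := by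
  rcases le_or_gt y (n - i) with h | h
  · exact hf.coeff_lt_coeff hxy hx hy0 h
  · rw [← hf.coeff_sub y]
    exact hf.coeff_lt_coeff hxy' hx (by omega) (by have := hf.two_mul_le; omega)

theorem mul_bracket (hf : IsSymmTrapezoid f n i) (c : ℕ) :
    IsSymmTrapezoid (f * bracket (c + 1)) (n + c) (min (min (i + c) n) ((n + c) / 2)) where
  two_mul_le := by omega
  coeff_of_neg k hk := by
    rw [coeff_mul_bracket]
    exact sum_eq_zero fun j _ => hf.coeff_of_neg _ (by omega)
  coeff_sub k := by
    rw [coeff_mul_bracket, coeff_mul_bracket, ← sum_range_reflect]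
    refine sum_congr rfl fun j hj => ?_
    rw [← hf.coeff_sub]
    congr 1
    have := mem_range.1 hj
    omega
  lt_succ k hk hk' := by
    have h := coeff_mul_bracket_succ_sub f (c + 1) k
    have hlt := hf.coeff_lt_coeff_of_lt_sub (x := k + 1 - (c + 1 : ℕ)) (y := k + 1)
      (by omega) (by omega) (by omega) (by omega) (by omega)
    omega
  eq_succ k hk hk' := by
    have h := coeff_mul_bracket_succ_sub f (c + 1) k
    suffices f.coeff (k + 1) = f.coeff (k + 1 - (c + 1 : ℕ)) by omega
    rcases le_or_gt (n : ℤ) k with hn | hn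
    · rw [hf.coeff_of_gt (by omega), hf.coeff_of_neg _ (by omega)]
    by_cases hmid : k + 1 = n - (k + 1 - (c + 1 : ℕ))
    · rw [← hf.coeff_sub (k + 1 - _), ← hmid]
    · exact (hf.coeff_eq_of_mem_plateau (by omega) (by omega) (by omega)).symm

theorem coeff_pos (hf : IsSymmTrapezoid f n i) {k : ℤ} (hk : 0 ≤ k) (hkn : k ≤ n) :
    0 < f.coeff k := by
  simpa only [hf.coeff_of_neg (-1) (by omega)] using
    hf.coeff_lt_coeff_of_lt_sub (x := -1) (by omega) (by omega) (by omega) hk hkn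

theorem isExpansion (hf : IsSymmTrapezoid f n i) : IsExpansion f 0 n fun k => f.coeff k := by
  refine ⟨?_, (hf.coeff_pos le_rfl (by omega)).ne', (hf.coeff_pos (by omega) le_rfl).ne'⟩
  ext m
  simp only [← single_eq_C_mul_T, AddMonoidAlgebra.coeff_sum, Finsupp.finsetSum_apply, add_zero,
    AddMonoidAlgebra.coeff_single, Finsupp.single_apply]
  by_cases hm : 0 ≤ m ∧ m ≤ n
  · rw [sum_eq_single_of_mem m.toNat (mem_range.2 (by omega)) fun k _ hk => if_neg (by omega),
      Int.toNat_of_nonneg hm.1, if_pos rfl]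
  · rw [sum_eq_zero fun k hk => if_neg (by have := mem_range.1 hk; omega)]
    rcases lt_or_ge m 0 with h | h
    · exact hf.coeff_of_neg m h
    · exact hf.coeff_of_gt (by omega)

theorem hasPositiveCoeffs (hf : IsSymmTrapezoid f n i) : HasPositiveCoeffs f :=
  ⟨0, n, _, hf.isExpansion, fun _ hk => hf.coeff_pos (by omega) (by omega)⟩

theorem isSymmetricLaurent (hf : IsSymmTrapezoid f n i) : IsSymmetricLaurent f :=
  ⟨0, n, _, hf.isExpansion, fun k hk => by rw [Nat.cast_sub hk, hf.coeff_sub]⟩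

theorem isTrapezoidal (hf : IsSymmTrapezoid f n i) : IsTrapezoidal f := by
  have hi := hf.two_mul_le
  refine ⟨0, n, _, hf.isExpansion, i, n - i, by omega, by omega, fun k hk => ?_,
    fun k hk hk' => ?_, fun k hk hk' => ?_⟩
  · exact_mod_cast hf.lt_succ k (by omega) (by omega)
  · exact_mod_cast hf.eq_succ k (by omega) (by omega)
  · rw [← hf.coeff_sub, ← hf.coeff_sub k]
    exact hf.coeff_lt_coeff (by omega) (by omega) (by omega) (by omega)

theorem isStableLength (hf : IsSymmTrapezoid f n i) : IsStableLength f (n - 2 * i) := by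
  have hi := hf.two_mul_le
  refine ⟨0, n, _, hf.isExpansion, ⟨i, by omega, fun j hj => ?_⟩, ?_⟩
  · exact (hf.coeff_eq_of_mem_plateau (by omega) (by omega) (by omega)).symm
  · rintro m ⟨k, hkn, hk⟩
    by_contra! hm
    rcases lt_or_ge k i with h | h
    · exact (hf.lt_succ k (by omega) (by omega)).ne' (by exact_mod_cast hk 1 (by omega))
    · have hlast : f.coeff (k + m - 1 : ℕ) = f.coeff (k + m : ℕ) := by
        rw [Nat.add_sub_assoc (by omega), hk _ (by omega), hk m le_rfl]
      rw [← hf.coeff_sub, ← hf.coeff_sub (k + m : ℕ)] at hlast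
      exact (hf.coeff_lt_coeff (by omega) (by omega) (by omega) (by omega)).ne' hlast

end IsSymmTrapezoid

theorem isSymmTrapezoid_bracket_mul_bracket_mul_bracket {p q r : ℕ} (hp : 0 < p) (hq : 0 < q)
    (hr : 0 < r) :
    ∃ n i : ℕ, IsSymmTrapezoid (bracket p * bracket q * bracket r) n i ∧
      ((n - 2 * i : ℕ) : ℤ) ≤ |(q : ℤ) + 1 - p - r| := by
  obtain ⟨p, rfl⟩ := Nat.exists_eq_add_one.2 hp
  obtain ⟨q, rfl⟩ := Nat.exists_eq_add_one.2 hq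
  obtain ⟨r, rfl⟩ := Nat.exists_eq_add_one.2 hr
  have h := ((isSymmTrapezoid_one.mul_bracket p).mul_bracket q).mul_bracket r
  rw [one_mul] at h
  exact ⟨_, _, h, le_abs.2 (by omega)⟩

end Coefficients

section MatrixSignature

open Matrix Polynomial

variable {ι : Type*} [Fintype ι] [DecidableEq ι]

theorem matrixSignature_eq_sum_sign (S : Matrix ι ι ℝ) :
    matrixSignature S = (S.charpoly.roots.map fun x => (SignType.sign x : ℤ)).sum := by
  rw [matrixSignature]
  induction S.charpoly.roots using Multiset.induction_on with
  | empty => simp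
  | cons x s ih =>
    rw [Multiset.countP_cons, Multiset.countP_cons, Multiset.map_cons, Multiset.sum_cons, ← ih]
    rcases lt_trichotomy x 0 with h | rfl | h
    · simp only [h, h.not_gt, if_true, if_false, sign_neg h, SignType.coe_neg_one, Nat.cast_add,
        Nat.cast_one, add_zero]
      ring
    · simp
    · simp only [h, h.not_gt, if_true, if_false, sign_pos h, SignType.coe_one, Nat.cast_add,
        Nat.cast_one, add_zero]
      ring

theorem matrixSignature_of_blockTriangular {α : Type*} [LinearOrder α] {S : Matrix ι ι ℝ}
    {b : ι → α} (hS : S.BlockTriangular b) :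
    matrixSignature S = ∑ a ∈ Finset.univ.image b, matrixSignature (S.toSquareBlock b a) := by
  simp only [matrixSignature_eq_sum_sign]
  rw [hS.charpoly, roots_prod _ _ (Finset.prod_ne_zero_iff.2 fun a _ => (charpoly_monic _).ne_zero),
    Multiset.map_bind, Multiset.sum_bind]
  rfl

theorem matrixSignature_smul_of_posDef {G : Matrix ι ι ℝ} (hG : G.PosDef) (c : ℝ) :
    matrixSignature (c • G) = SignType.sign c * (Fintype.card ι : ℤ) := by
  have hc : (c • G).IsHermitian := hG.isHermitian.smul (IsSelfAdjoint.all c)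
  have hsign (i : ι) : SignType.sign (hc.eigenvalues i) = SignType.sign c := by
    have hv : hc.eigenvectorBasis i ≠ 0 := hc.eigenvectorBasis.orthonormal.ne_zero i
    have hpos := hG.dotProduct_mulVec_pos (x := (hc.eigenvectorBasis i).ofLp) (by simpa using hv)
    rw [hc.eigenvalues_eq, smul_mulVec, dotProduct_smul, smul_eq_mul, RCLike.re_to_real, sign_mul,
      sign_pos hpos, mul_one]
  rw [matrixSignature_eq_sum_sign, hc.roots_charpoly_eq_eigenvalues]
  simp [hsign, mul_comm]

theorem matrixSignature_diagonal_mul_posDef {ε : ι → ℝ} {G : Matrix ι ι ℝ} (hG : G.PosDef)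
    (hεG : (diagonal ε * G).IsHermitian) :
    matrixSignature (diagonal ε * G) = ∑ i, (SignType.sign (ε i) : ℤ) := by
  have hblock : (diagonal ε * G).BlockTriangular ε := by
    intro i j hij
    have hsymm := hεG.apply i j
    have hG' := hG.isHermitian.apply i j
    rw [diagonal_mul, diagonal_mul, star_trivial] at hsymm
    rw [star_trivial] at hG'
    have hG0 : G i j = 0 := by
      refine (mul_eq_zero.1 ?_).resolve_left (sub_ne_zero.2 hij.ne')
      linear_combination ε j * hG' - hsymm
    rw [diagonal_mul, hG0, mul_zero]
  rw [matrixSignature_of_blockTriangular hblock,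
    ← Finset.sum_fiberwise_of_maps_to fun i _ => Finset.mem_image_of_mem ε (Finset.mem_univ i)]
  refine Finset.sum_congr rfl fun c _ => ?_
  have hc : (diagonal ε * G).toSquareBlock ε c = c • G.toSquareBlock ε c := by
    ext i j
    rw [toSquareBlock_def, of_apply, diagonal_mul, i.2]
    rfl
  have hpos : (G.toSquareBlock ε c).PosDef := hG.submatrix Subtype.val_injective
  rw [hc, matrixSignature_smul_of_posDef hpos, Fintype.card_subtype, mul_comm, ← nsmul_eq_mul]
  exact (Finset.sum_eq_card_nsmul fun i hi => by rw [(Finset.mem_filter.1 hi).2]).symm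

end MatrixSignature

section SeifertLoops

open Matrix

theorem card_filter_get_eq_countP {α : Type*} (l : List α) (p : α → Prop) [DecidablePred p] :
    (Finset.univ.filter fun i => p (l.get i)).card = l.countP p := by
  conv_rhs => rw [← List.map_get_finRange l, List.countP_map, List.countP_eq_length_filter]
  rfl

variable {n : ℕ} {w : BraidWord n}

namespace SeifertLoop

theorem fst_lt_snd (a : SeifertLoop w) : a.fst < a.snd := a.2.1

theorem generator_snd (a : SeifertLoop w) : (w.get a.snd).1 = (w.get a.fst).1 := a.2.2.1.symm

theorem generator_ne_of_between (a : SeifertLoop w) {l : Fin w.length} (hl : a.fst < l)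
    (hl' : l < a.snd) : (w.get l).1 ≠ (w.get a.fst).1 := a.2.2.2 l hl hl'

theorem ext_fst_snd {a b : SeifertLoop w} (hfst : a.fst = b.fst) (hsnd : a.snd = b.snd) : a = b :=
  Subtype.ext (Prod.ext hfst hsnd)

theorem fst_injective : Function.Injective (fst : SeifertLoop w → Fin w.length) := by
  have snd_le {a b : SeifertLoop w} (h : a.fst = b.fst) : a.snd ≤ b.snd := by
    by_contra! hlt
    exact a.generator_ne_of_between (h ▸ b.fst_lt_snd) hlt (h ▸ b.generator_snd)
  exact fun a b h => ext_fst_snd h ((snd_le h).antisymm (snd_le h.symm))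

theorem snd_injective : Function.Injective (snd : SeifertLoop w → Fin w.length) := by
  have fst_le {a b : SeifertLoop w} (h : a.snd = b.snd) : a.fst ≤ b.fst := by
    by_contra! hlt
    refine b.generator_ne_of_between hlt (h ▸ a.fst_lt_snd) ?_
    rw [← a.generator_snd, h, b.generator_snd]
  exact fun a b h => ext_fst_snd ((fst_le h).antisymm (fst_le h.symm)) h

theorem exists_snd_eq {m l : Fin w.length} (hml : m < l) (hgen : (w.get m).1 = (w.get l).1) :
    ∃ a : SeifertLoop w, a.snd = l := by
  let s := Finset.univ.filter fun k => k < l ∧ (w.get k).1 = (w.get l).1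
  have hs : s.Nonempty := ⟨m, Finset.mem_filter.2 ⟨Finset.mem_univ m, hml, hgen⟩⟩
  obtain ⟨hlt, hmax⟩ := (Finset.mem_filter.1 (s.max'_mem hs)).2
  refine ⟨⟨(s.max' hs, l), hlt, hmax, fun k hk hkl hgen' => hk.not_ge ?_⟩, rfl⟩
  exact s.le_max' k (Finset.mem_filter.2 ⟨Finset.mem_univ k, hkl, hgen'.trans hmax⟩)

theorem card_generator_eq (w : BraidWord n) (g : Fin (n - 1)) :
    (Finset.univ.filter fun a : SeifertLoop w => (w.get a.fst).1 = g).card =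
      w.countP (fun x => x.1 = g) - 1 := by
  let s := Finset.univ.filter fun l => (w.get l).1 = g
  rw [← card_filter_get_eq_countP w fun x => x.1 = g]
  change _ = s.card - 1
  rcases s.eq_empty_or_nonempty with hs | hs
  · rw [hs, Finset.card_empty, Finset.card_eq_zero, Finset.filter_eq_empty_iff]
    exact fun a _ => Finset.filter_eq_empty_iff.1 hs (Finset.mem_univ a.fst)
  rw [← Finset.card_erase_of_mem (s.min'_mem hs)]
  refine Finset.card_nbij snd (fun a ha => ?_) snd_injective.injOn fun l hl => ?_
  · have hfst : (w.get a.fst).1 = g := (Finset.mem_filter.1 ha).2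
    have hmin : s.min' hs ≤ a.fst := s.min'_le _ (by simpa [s] using hfst)
    refine Finset.mem_erase.2 ⟨(hmin.trans_lt a.fst_lt_snd).ne', ?_⟩
    exact Finset.mem_filter.2 ⟨Finset.mem_univ _, a.generator_snd.trans hfst⟩
  · obtain ⟨hne, hls⟩ := Finset.mem_erase.1 hl
    have hlg : (w.get l).1 = g := (Finset.mem_filter.1 hls).2
    have hming : (w.get (s.min' hs)).1 = g := (Finset.mem_filter.1 (s.min'_mem hs)).2
    obtain ⟨a, rfl⟩ := exists_snd_eq ((s.min'_le l hls).lt_of_ne' hne) (hming.trans hlg.symm)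
    exact ⟨a, by simpa using a.generator_snd.symm.trans hlg, rfl⟩

end SeifertLoop

/-- The boundary map from Seifert loops to bands, with which the symmetrized Seifert form is
compared. -/
def loopBoundary (w : BraidWord n) : Matrix (Fin w.length) (SeifertLoop w) ℝ :=
  Matrix.of fun l a => (if a.snd = l then 1 else 0) - (if a.fst = l then 1 else 0)

theorem loopBoundary_gram_apply (a b : SeifertLoop w) :
    ((loopBoundary w)ᴴ * loopBoundary w) a b =
      (if b.snd = a.snd then 1 else 0) + (if b.fst = a.fst then 1 else 0) -
        (if b.snd = a.fst then 1 else 0) - (if b.fst = a.snd then 1 else 0) := by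
  simp only [mul_apply, conjTranspose_apply, loopBoundary, of_apply, star_trivial, sub_mul,
    Finset.sum_sub_distrib, ite_mul, one_mul, zero_mul, Finset.sum_ite_eq, Finset.mem_univ, if_true]
  ring

theorem posDef_loopBoundary_gram (w : BraidWord n) :
    ((loopBoundary w)ᴴ * loopBoundary w).PosDef := by
  refine PosDef.conjTranspose_mul_self _ ?_
  rw [← coe_mulVecLin, injective_iff_map_eq_zero]
  intro x hx
  suffices h : ∀ l, ∀ a : SeifertLoop w, a.fst = l → x a = 0 from funext fun a => h _ a rfl
  intro l
  induction l using WellFoundedLT.induction with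
  | ind l ih =>
    rintro a rfl
    have hrow := congrFun hx a.fst
    simp only [mulVecLin_apply, mulVec, dotProduct, loopBoundary, of_apply, Pi.zero_apply,
      sub_mul, Finset.sum_sub_distrib, ite_mul, one_mul, zero_mul,
      SeifertLoop.fst_injective.eq_iff, Finset.sum_ite_eq', Finset.mem_univ, if_true] at hrow
    rw [Finset.sum_eq_zero, zero_sub, neg_eq_zero] at hrow
    · exact hrow
    · intro b _
      rw [ite_eq_right_iff]
      exact fun hb => ih _ (hb ▸ b.fst_lt_snd) b rfl

section Sorted

theorem SeifertLoop.val_snd_of_sorted (hw : w.Pairwise fun x y => x.1 ≤ y.1) (a : SeifertLoop w) :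
    (a.snd : ℕ) = a.fst + 1 := by
  have hlt : (a.fst : ℕ) < a.snd := a.fst_lt_snd
  by_contra hne
  have hmid : (a.fst : ℕ) + 1 < w.length := by omega
  have hl : a.fst < ⟨a.fst + 1, hmid⟩ := Fin.lt_def.2 (by simp)
  have hl' : ⟨a.fst + 1, hmid⟩ < a.snd := Fin.lt_def.2 (by simp only; omega)
  refine a.generator_ne_of_between hl hl' (le_antisymm ?_ (List.pairwise_iff_get.1 hw _ _ hl))
  exact (List.pairwise_iff_get.1 hw _ _ hl').trans_eq a.generator_snd

variable {ε : Fin (n - 1) → Bool}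

theorem crossingSign_eq_one_or_neg_one (x : Fin (n - 1) × Bool) :
    crossingSign x = 1 ∨ crossingSign x = -1 := by
  unfold crossingSign
  split_ifs <;> simp

theorem crossingSign_get_of_sign_eq (hε : ∀ x ∈ w, x.2 = ε x.1) (l : Fin w.length) :
    crossingSign (w.get l) = crossingSign ((w.get l).1, ε (w.get l).1) := by
  rw [crossingSign, crossingSign, hε _ (w.get_mem l)]

theorem seifertEntry_of_sorted (hw : w.Pairwise fun x y => x.1 ≤ y.1) (hε : ∀ x ∈ w, x.2 = ε x.1)
    (a b : SeifertLoop w) :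
    seifertEntry a b =
      if a = b then -crossingSign (w.get a.fst)
      else if b.snd = a.fst ∧ crossingSign (w.get a.fst) = 1 then 1
      else if a.snd = b.fst ∧ crossingSign (w.get a.fst) = -1 then -1
      else 0 := by
  have ha := a.val_snd_of_sorted hw
  have hb := b.val_snd_of_sorted hw
  have hsign : crossingSign (w.get a.snd) = crossingSign (w.get a.fst) := by
    rw [crossingSign_get_of_sign_eq hε, crossingSign_get_of_sign_eq hε a.fst, a.generator_snd]
  have h₁ : ¬(b.fst < a.fst ∧ a.fst < b.snd ∧ b.snd < a.snd) := by
    simp only [Fin.lt_def]; omega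
  have h₂ : ¬(a.fst < b.fst ∧ b.fst < a.snd ∧ a.snd < b.snd) := by
    simp only [Fin.lt_def]; omega
  rw [seifertEntry, hsign, if_pos rfl, if_neg h₁, if_neg h₂, ite_self]

theorem seifertEntry_add_seifertEntry_of_sorted (hw : w.Pairwise fun x y => x.1 ≤ y.1)
    (hε : ∀ x ∈ w, x.2 = ε x.1) (a b : SeifertLoop w) :
    ((seifertEntry a b + seifertEntry b a : ℤ) : ℝ) =
      -(crossingSign (w.get a.fst)) * ((loopBoundary w)ᴴ * loopBoundary w) a b := by
  have hsign {a b : SeifertLoop w} (h : a.snd = b.fst) :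
      crossingSign (w.get b.fst) = crossingSign (w.get a.fst) := by
    rw [← h, crossingSign_get_of_sign_eq hε, crossingSign_get_of_sign_eq hε a.fst, a.generator_snd]
  rw [loopBoundary_gram_apply, seifertEntry_of_sorted hw hε, seifertEntry_of_sorted hw hε]
  simp only [SeifertLoop.fst_injective.eq_iff, SeifertLoop.snd_injective.eq_iff]
  rcases eq_or_ne a b with rfl | hab
  · simp only [if_true, a.fst_lt_snd.ne, a.fst_lt_snd.ne', if_false]
    push_cast
    ring
  by_cases hba' : b.snd = a.fst
  · have hab' : a.snd ≠ b.fst := fun h =>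
      (a.fst_lt_snd.trans_eq h).not_gt (b.fst_lt_snd.trans_eq hba')
    rcases crossingSign_eq_one_or_neg_one (w.get a.fst) with h | h <;>
      simp only [hab, hab.symm, hab', hab'.symm, hba', ← hsign hba', h] <;> norm_num
  by_cases hab' : a.snd = b.fst
  · rcases crossingSign_eq_one_or_neg_one (w.get a.fst) with h | h <;>
      simp only [hab, hab.symm, hab', hba', hsign hab', h] <;> norm_num
  · simp [hab, hab.symm, hab', hba', Ne.symm hab']

theorem linkSignature_of_sorted (hw : w.Pairwise fun x y => x.1 ≤ y.1)
    (hε : ∀ x ∈ w, x.2 = ε x.1) :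
    linkSignature w =
      -∑ g, crossingSign (g, ε g) * ((w.countP (fun x => x.1 = g) - 1 : ℕ) : ℤ) := by
  let c (a : SeifertLoop w) : ℝ := -(crossingSign (w.get a.fst))
  have hS : (seifertMatrix w + (seifertMatrix w)ᵀ).map (Int.cast : ℤ → ℝ) =
      diagonal c * ((loopBoundary w)ᴴ * loopBoundary w) := by
    ext a b
    rw [diagonal_mul]
    exact seifertEntry_add_seifertEntry_of_sorted hw hε a b
  have hherm : (diagonal c * ((loopBoundary w)ᴴ * loopBoundary w)).IsHermitian := by
    rw [← hS]
    ext a b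
    simp [add_comm]
  have hsign (a : SeifertLoop w) : (SignType.sign (c a) : ℤ) =
      -crossingSign ((w.get a.fst).1, ε (w.get a.fst).1) := by
    rw [← crossingSign_get_of_sign_eq hε]
    rcases crossingSign_eq_one_or_neg_one (w.get a.fst) with h | h <;>
      simp only [c, h] <;> norm_num
  rw [linkSignature, hS, matrixSignature_diagonal_mul_posDef (posDef_loopBoundary_gram w) hherm,
    Finset.sum_congr rfl fun a _ => hsign a, Finset.sum_neg_distrib, neg_inj,
    ← Finset.sum_fiberwise Finset.univ fun a => (w.get a.fst).1]
  refine Finset.sum_congr rfl fun g _ => ?_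
  rw [← SeifertLoop.card_generator_eq, mul_comm, ← nsmul_eq_mul]
  exact Finset.sum_eq_card_nsmul fun a ha => by rw [(Finset.mem_filter.1 ha).2]

theorem linkSignature_fourBraidWord {p q r : ℕ} (hp : 0 < p) (hq : 0 < q) (hr : 0 < r) :
    linkSignature (fourBraidWord p q r) = (q : ℤ) + 1 - p - r := by
  have hsorted : (fourBraidWord p q r).Pairwise fun x y => x.1 ≤ y.1 := by
    simp [fourBraidWord, List.pairwise_append, List.pairwise_replicate]
  rw [linkSignature_of_sorted (ε := fun g => decide (Even (g : ℕ))) hsorted fun x hx => by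
    rw [Bool.eq_iff_iff, sign_fourBraidWord_iff_even x hx, decide_eq_true_iff]]
  change -∑ g : Fin 3, _ = _
  simp [Fin.sum_univ_three, fourBraidWord, List.countP_append, List.countP_replicate, crossingSign]
  omega

end Sorted

end SeifertLoops

theorem mainTheorem2 (p q r : ℕ) (hp : 0 < p) (hq : 0 < q) (hr : 0 < r) :
    -- the closure `L` of the braid word `σ₁ᵖ σ₂⁻ᵠ σ₃ʳ` is an alternating diagram
    IsAlternatingClosure (fourBraidWord p q r) ∧
    -- up to a unit of `ℤ[t^{1/2}, t^{-1/2}]`, its Alexander polynomial is `[p] [q] [r]` at `s = -t`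
    (∃ u : HalfLaurentˣ, alexanderPolynomial (fourBraidWord p q r).toBraid =
      algebraMap HalfLaurent (FractionRing HalfLaurent)
        (u * substNeg (bracket p * bracket q * bracket r))) ∧
    -- this polynomial in `s` is trapezoidal, with stable part of length at most `|σ(L)|`
    HasPositiveCoeffs (bracket p * bracket q * bracket r) ∧
    IsSymmetricLaurent (bracket p * bracket q * bracket r) ∧
    IsTrapezoidal (bracket p * bracket q * bracket r) ∧
    ∃ l : ℕ, IsStableLength (bracket p * bracket q * bracket r) l ∧
      (l : ℤ) ≤ |linkSignature (fourBraidWord p q r)| := by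
  obtain ⟨n, i, htrap, hle⟩ := isSymmTrapezoid_bracket_mul_bracket_mul_bracket hp hq hr
  refine ⟨isAlternatingClosure_of_sign_alternates sign_fourBraidWord_iff_even,
    alexanderPolynomial_fourBraidWord p q r, htrap.hasPositiveCoeffs, htrap.isSymmetricLaurent,
    htrap.isTrapezoidal, n - 2 * i, htrap.isStableLength, ?_⟩
  rwa [linkSignature_fourBraidWord hp hq hr]
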